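/- Let $G$ be a finite simple graph on $n$ vertices. A claw of $G$ is an induced subgraph isomorphic to $K_{1,3}$; its three vertices of degree 1 are called its end vertices. $G$ is called claw-heavy if every claw of $G$ has two end vertices $x, y$ with $d_G(x)+d_G(y)\ge n$. $G$ is called almost distance-hereditary if every connected induced subgraph $H$ of $G$ satisfies $d_H(x,y)\le d_G(x,y)+1$ for all $x,y\in V(H)$, where $d_H(x,y)$ and $d_G(x,y)$ are the distances in $H$ and in $G$. $G$ is called 2-connected if $n\ge 3$ and $G$ remains connected after the deletion of any set of fewer than two vertices. If $G$ is 2-connected, claw-heavy and almost distance-hereditary, then $G$ is Hamiltonian, that is, $G$ contains a cycle through all of its vertices. -/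

import Mathlib

namespace SimpleGraph

/-- `G` is `k`-connected: it has more than `k` vertices and deleting fewer than `k` vertices
always leaves a connected graph. -/
def IsVertexConnected {V : Type*} [Fintype V] (G : SimpleGraph V) (k : ℕ) : Prop :=
  k < Fintype.card V ∧
    ∀ S : Finset V, S.card < k → (G.induce {v : V | v ∉ S}).Connected

/-- `G` is almost distance-hereditary: in each connected induced subgraph `H`, distances satisfy
`d_H(x, y) ≤ d_G(x, y) + 1`. As `H` is connected, neither distance is infinite. -/
def IsAlmostDistanceHereditary {V : Type*} (G : SimpleGraph V) : Prop :=
  ∀ S : Set V, (G.induce S).Connected →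
    ∀ x y : S, (G.induce S).dist x y ≤ G.dist (x : V) (y : V) + 1

/-- `c, x, y, z` induce a claw (`K_{1,3}`) in `G` with center `c` and end vertices `x, y, z`. -/
structure IsClaw {V : Type*} (G : SimpleGraph V) (c x y z : V) : Prop where
  adj_x : G.Adj c x
  adj_y : G.Adj c y
  adj_z : G.Adj c z
  ne_xy : x ≠ y
  ne_xz : x ≠ z
  ne_yz : y ≠ z
  not_adj_xy : ¬ G.Adj x y
  not_adj_xz : ¬ G.Adj x z
  not_adj_yz : ¬ G.Adj y z

/-- `G` is claw-heavy: every claw has two end vertices with degree sum at least `|V(G)|`. -/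
def IsClawHeavy {V : Type*} [Fintype V] (G : SimpleGraph V) [DecidableRel G.Adj] : Prop :=
  ∀ c x y z : V, G.IsClaw c x y z →
    Fintype.card V ≤ G.degree x + G.degree y ∨
    Fintype.card V ≤ G.degree x + G.degree z ∨
    Fintype.card V ≤ G.degree y + G.degree z

end SimpleGraph

/-! Treat two vertices as joined if they are adjacent or if their degree sum is at least `n`. A
cycle in this wider sense can be replaced by a genuine cycle at least as long
(`exists_cycleList_of_heavy`), so both kinds of pair may be used when rerouting a longest cycle.

Suppose a longest cycle misses a vertex, and let `H` be the component of that vertex off the cycle.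
No heavy path through exactly the cycle vertices can have both ends joined to `H`
(`LongestCycle.no_path`). With claw-heaviness this implies that a cycle vertex without neighbours in
`H` is joined to no vertex of `H`, and that its unattached cycle neighbours around an attached
vertex are pairwise joined.

2-connectedness gives at least two attached vertices. Between consecutive ones `f a`, `f b`, almost
distance-heredity yields a common neighbour `f q` of `f (a + 1)` and `f b`, a rung, and makes `f a`
and `f b` share their neighbours in `H` (`exists_rung`). Hence one `x` in `H` sees every attached
vertex. Reroutings forbid most pairs near two consecutive rungs, and degree sums force some others
to be edges. What remains is a path of seven vertices through `x` whose ends are at distance at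
least 5 in the subgraph it induces but at most 3 in `G` (`no_long_path`). -/

namespace SimpleGraph

/-! ### Heavy cycles and their conversion into genuine cycles. -/

variable {V : Type*}

/-- `u` and `v` are adjacent or have degree sum at least the order of the graph. -/
def HeavyAdj [Fintype V] (G : SimpleGraph V) [DecidableRel G.Adj] (u v : V) : Prop :=
  G.Adj u v ∨ Fintype.card V ≤ G.degree u + G.degree v

theorem HeavyAdj.symm [Fintype V] {G : SimpleGraph V} [DecidableRel G.Adj] {u v : V}
    (h : G.HeavyAdj u v) : G.HeavyAdj v u := by
  rcases h with h | h
  · exact Or.inl h.symm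
  · exact Or.inr (by omega)

theorem Adj.heavyAdj [Fintype V] {G : SimpleGraph V} [DecidableRel G.Adj] {u v : V}
    (h : G.Adj u v) : G.HeavyAdj u v :=
  Or.inl h

/-- The number of consecutive nonadjacent pairs in a list. -/
def gaps (G : SimpleGraph V) [DecidableRel G.Adj] : List V → ℕ
  | [] => 0
  | [_] => 0
  | a :: b :: l => (if G.Adj a b then 0 else 1) + gaps G (b :: l)

section
variable (G : SimpleGraph V) [DecidableRel G.Adj]

theorem gaps_append (l₁ l₂ : List V) (a b : V) :
    G.gaps (l₁ ++ a :: b :: l₂) =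
      G.gaps (l₁ ++ [a]) + (if G.Adj a b then 0 else 1) + G.gaps (b :: l₂) := by
  induction l₁ with
  | nil => simp [gaps]
  | cons c l ih =>
    cases l with
    | nil => simp [gaps]; omega
    | cons d l => simp only [List.cons_append, gaps] at ih ⊢; omega

theorem gaps_reverse (l : List V) : G.gaps l.reverse = G.gaps l := by
  induction l with
  | nil => rfl
  | cons a l ih =>
    cases l with
    | nil => rfl
    | cons b l =>
      have h := G.gaps_append l.reverse [] b a
      simp only [List.reverse_cons, List.append_assoc, List.cons_append, List.nil_append,
        gaps] at ih h ⊢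
      rw [h, ih]
      simp only [G.adj_comm b a]
      omega

theorem exists_gap (l : List V) (h : G.gaps l ≠ 0) :
    ∃ l₁ a b l₂, l = l₁ ++ a :: b :: l₂ ∧ ¬ G.Adj a b := by
  induction l with
  | nil => simp [gaps] at h
  | cons a l ih =>
    cases l with
    | nil => simp [gaps] at h
    | cons b l =>
      by_cases hab : G.Adj a b
      · simp only [gaps, hab, if_true, zero_add] at h
        obtain ⟨l₁, c, d, l₂, h1, h2⟩ := ih h
        exact ⟨a :: l₁, c, d, l₂, by simp [h1], h2⟩
      · exact ⟨[], a, b, l, rfl, hab⟩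

theorem isChain_adj_of_gaps (l : List V) (h : G.gaps l = 0) : l.IsChain G.Adj := by
  induction l with
  | nil => exact .nil
  | cons a l ih =>
    cases l with
    | nil => exact .singleton a
    | cons b l =>
      simp only [gaps] at h
      split_ifs at h with hab
      · exact .cons_cons hab (ih (by omega))
      · omega
end

/-- `l` lists the vertices of a cycle of length at least three with respect to `R`. -/
structure IsCycleList (R : V → V → Prop) (l : List V) : Prop where
  three_le : 3 ≤ l.length
  nodup : l.Nodup
  isChain : l.IsChain R
  closing : ∀ a ∈ l.getLast?, ∀ b ∈ l.head?, R a b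

/-- In a list whose ends have degree sum at least the order and have no common neighbour off the
list, some consecutive pair `c, d` has `d` adjacent to the first and `c` to the last vertex. -/
theorem exists_crossing [Fintype V] (G : SimpleGraph V) [DecidableRel G.Adj] {l : List V} {u v : V}
    (hl : l.Nodup) (hu : l.head? = some u) (hv : l.getLast? = some v)
    (hdeg : Fintype.card V ≤ G.degree u + G.degree v)
    (hout : ∀ z, z ∉ l → G.Adj u z → ¬ G.Adj v z) :
    ∃ l₁ c d l₂, l = l₁ ++ c :: d :: l₂ ∧ G.Adj u d ∧ G.Adj v c := by
  classical
  by_contra hcon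
  push Not at hcon
  have hne : l ≠ [] := by rintro rfl; simp at hu
  have hlen : 0 < l.length := List.length_pos_of_ne_nil hne
  have hget0 : l[0] = u := by
    rw [List.head?_eq_getElem?, List.getElem?_eq_getElem hlen] at hu
    exact Option.some.inj hu
  have hgetl : l[l.length - 1] = v := by
    rw [List.getLast?_eq_getElem?, List.getElem?_eq_getElem (by omega)] at hv
    exact Option.some.inj hv
  have hno : ∀ i (hi : i + 1 < l.length), G.Adj u l[i+1] → ¬ G.Adj v l[i] := by
    intro i hi
    refine hcon (l.take i) l[i] l[i+1] (l.drop (i+2)) ?_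
    rw [← List.drop_eq_getElem_cons hi, ← List.drop_eq_getElem_cons (by omega),
      List.take_append_drop]
  -- Neighbours of `u` on the list move to their predecessors, the others stay. Without a crossing
  -- pair the image is disjoint from the neighbourhood of `v`, and `v` lies in neither, so the
  -- degree sum is below the order.
  let g : V → V := fun y => if h : y ∈ l then l[l.idxOf y - 1]'(by
    have := List.idxOf_lt_length_of_mem h; omega) else y
  have gin : ∀ y, y ∈ l → y ≠ u → ∃ i, ∃ hi : i + 1 < l.length, y = l[i+1] ∧ g y = l[i] := by
    intro y hy hyu
    have h1 := List.idxOf_lt_length_of_mem hy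
    have h2 : l[l.idxOf y] = y := List.getElem_idxOf h1
    have h3 : l.idxOf y ≠ 0 := by
      intro h0
      apply hyu
      rw [← h2, ← hget0]
      simp [h0]
    refine ⟨l.idxOf y - 1, by omega, ?_, by simp [g, hy]⟩
    have h4 : l.idxOf y - 1 + 1 = l.idxOf y := by omega
    simp only [h4, h2]
  have gout : ∀ y, y ∉ l → g y = y := fun y hy => by simp [g, hy]
  have hinj : Set.InjOn g (G.neighborFinset u) := by
    intro y hy z hz hyz
    simp only [Finset.mem_coe, mem_neighborFinset] at hy hz
    by_cases h1 : y ∈ l <;> by_cases h2 : z ∈ l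
    · obtain ⟨i, hi, e1, e2⟩ := gin y h1 hy.ne'
      obtain ⟨j, hj, e3, e4⟩ := gin z h2 hz.ne'
      rw [e2, e4, hl.getElem_inj_iff] at hyz
      subst hyz; rw [e1, e3]
    · obtain ⟨i, hi, e1, e2⟩ := gin y h1 hy.ne'
      rw [e2, gout z h2] at hyz
      exact absurd (hyz ▸ List.getElem_mem _) h2
    · obtain ⟨i, hi, e1, e2⟩ := gin z h2 hz.ne'
      rw [e2, gout y h1] at hyz
      exact absurd (hyz ▸ List.getElem_mem _) h1
    · rwa [gout y h1, gout z h2] at hyz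
  have hdisj : Disjoint ((G.neighborFinset u).image g) (G.neighborFinset v) := by
    rw [Finset.disjoint_left]
    intro w hw
    obtain ⟨y, hy, rfl⟩ := Finset.mem_image.1 hw
    rw [mem_neighborFinset] at hy ⊢
    by_cases h1 : y ∈ l
    · obtain ⟨i, hi, e1, e2⟩ := gin y h1 hy.ne'
      rw [e2]; exact hno i hi (e1 ▸ hy)
    · rw [gout y h1]; exact hout y h1 hy
  have hv' : v ∉ (G.neighborFinset u).image g ∪ G.neighborFinset v := by
    simp only [Finset.mem_union, mem_neighborFinset, G.irrefl, or_false, Finset.mem_image, not_exists,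
      not_and]
    intro y hy hgy
    by_cases h1 : y ∈ l
    · obtain ⟨i, hi, e1, e2⟩ := gin y h1 hy.ne'
      rw [e2, ← hgetl, hl.getElem_inj_iff] at hgy
      omega
    · rw [gout y h1] at hgy
      exact h1 (hgy ▸ hgetl ▸ List.getElem_mem _)
  have hcard := Finset.card_lt_univ_of_notMem hv'
  rw [Finset.card_union_of_disjoint hdisj, Finset.card_image_of_injOn hinj,
    card_neighborFinset_eq_degree, card_neighborFinset_eq_degree] at hcard
  omega

/-- Induction on the number of nonadjacent consecutive pairs, the closing pair included. Each step
removes such a pair without losing a vertex. -/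
theorem exists_cycleList_of_heavy_aux [Fintype V] (G : SimpleGraph V) [DecidableRel G.Adj] (k : ℕ) :
    ∀ (l : List V) (u v : V), IsCycleList G.HeavyAdj l → l.head? = some u → l.getLast? = some v →
      G.gaps l + (if G.Adj v u then 0 else 1) ≤ k →
      ∃ l', IsCycleList G.Adj l' ∧ l.length ≤ l'.length := by
  induction k with
  | zero =>
    intro l u v hl hu hv hk
    split_ifs at hk with hvu
    · refine ⟨l, ⟨hl.three_le, hl.nodup, G.isChain_adj_of_gaps l (by omega), ?_⟩, le_rfl⟩
      rw [hu, hv]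
      simpa using hvu
    · omega
  | succ k ih =>
    have key : ∀ (l : List V) (u v : V), IsCycleList G.HeavyAdj l → l.head? = some u →
        l.getLast? = some v → ¬ G.Adj v u → G.gaps l ≤ k →
        ∃ l', IsCycleList G.Adj l' ∧ l.length ≤ l'.length := by
      intro l u v hl hu hv hvu hk
      have hdeg : Fintype.card V ≤ G.degree u + G.degree v := by
        rcases hl.closing v (by simp [hv]) u (by simp [hu]) with h | h
        · exact absurd h hvu
        · omega
      by_cases hout : ∃ z, z ∉ l ∧ G.Adj u z ∧ G.Adj v z
      -- A common neighbour off the cycle is inserted between `v` and `u`.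
      · obtain ⟨z, hz, huz, hvz⟩ := hout
        obtain ⟨t, rfl⟩ : ∃ t, l = t ++ [v] := List.getLast?_eq_some_iff.1 hv
        have hgap : G.gaps (t ++ [v] ++ [z]) = G.gaps (t ++ [v]) := by
          have := G.gaps_append t [] v z
          simpa [gaps, hvz] using this
        obtain ⟨l', h1, h2⟩ := ih (t ++ [v] ++ [z]) u z
          ⟨by have := hl.three_le; simp at this ⊢; omega, by
            rw [List.nodup_append]
            refine ⟨hl.nodup, by simp, ?_⟩
            rintro a ha b hb rfl
            simp only [List.mem_singleton] at hb
            exact hz (hb ▸ ha), by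
            refine hl.isChain.append (.singleton z) ?_
            simpa using hvz.heavyAdj, by
            rw [List.head?_append, hu]
            simpa using huz.symm.heavyAdj⟩ (by rw [List.head?_append, hu]; rfl) (by simp)
          (by rw [hgap]; simpa [huz.symm] using hk)
        exact ⟨l', h1, by simp at h2 ⊢; omega⟩
      · push Not at hout
        -- Reversing the part up to `c` trades the pairs `vu` and `cd` for the edges `ud` and `vc`.
        obtain ⟨l₁, c, d, l₂, rfl, hud, hvc⟩ :=
          G.exists_crossing hl.nodup hu hv hdeg hout
        have hv2 : (d :: l₂).getLast? = some v := by
          rw [List.getLast?_append] at hv; simpa using hv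
        have hu2 : (l₁ ++ [c]).head? = some u := by
          cases l₁ <;> simpa using hu
        obtain ⟨l₃, h3⟩ : ∃ l₃, (l₁ ++ [c]).reverse = l₃ ++ [u] := by
          rw [← List.getLast?_eq_some_iff, List.getLast?_reverse, hu2]
        have hch := hl.isChain
        rw [List.append_cons l₁ c (d :: l₂)] at hch
        have hperm : ((l₁ ++ [c]).reverse ++ (d :: l₂)).Perm (l₁ ++ c :: d :: l₂) := by
          rw [List.append_cons l₁ c (d :: l₂)]
          exact (List.reverse_perm _).append_right _
        have hhead : ((l₁ ++ [c]).reverse ++ (d :: l₂)).head? = some c := by simp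
        have hlast : ((l₁ ++ [c]).reverse ++ (d :: l₂)).getLast? = some v := by
          rw [List.getLast?_append, hv2]; rfl
        obtain ⟨l', h1, h2⟩ := ih ((l₁ ++ [c]).reverse ++ (d :: l₂)) c v
          ⟨hperm.length_eq ▸ hl.three_le, hperm.nodup_iff.2 hl.nodup, by
            refine List.IsChain.append ?_ hch.right_of_append ?_
            · rw [List.isChain_reverse]
              exact hch.left_of_append.imp fun a b h => h.symm
            · rw [List.getLast?_reverse, hu2]
              simpa using hud.heavyAdj, by
            rw [hhead, hlast]
            simpa using hvc.heavyAdj⟩ hhead hlast (by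
            have e1 := G.gaps_append l₃ l₂ u d
            have e2 := G.gaps_append l₁ l₂ c d
            rw [h3, List.append_assoc, List.singleton_append, e1, ← h3, gaps_reverse]
            simp only [hud, hvc, if_true]
            omega)
        exact ⟨l', h1, by rw [← hperm.length_eq]; exact h2⟩
    intro l u v hl hu hv hk
    by_cases hvu : G.Adj v u
    · by_cases h0 : G.gaps l = 0
      · exact ih l u v hl hu hv (by simp [hvu, h0])
      -- Rotating the list turns the gap `cd` into the closing pair.
      · obtain ⟨l₁, c, d, l₂, rfl, hcd⟩ := G.exists_gap l h0
        have hv2 : (d :: l₂).getLast? = some v := by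
          rw [List.getLast?_append] at hv; simpa using hv
        have hu2 : (l₁ ++ [c]).head? = some u := by
          cases l₁ <;> simpa using hu
        obtain ⟨l₃, h3⟩ : ∃ l₃, d :: l₂ = l₃ ++ [v] := List.getLast?_eq_some_iff.1 hv2
        obtain ⟨l₄, h4⟩ : ∃ l₄, l₁ ++ [c] = u :: l₄ := List.head?_eq_some_iff.1 hu2
        have hch := hl.isChain
        have hsum := G.gaps_append l₁ l₂ c d
        rw [List.append_cons l₁ c (d :: l₂)] at hch
        have hperm : ((d :: l₂) ++ (l₁ ++ [c])).Perm (l₁ ++ c :: d :: l₂) := by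
          rw [List.append_cons l₁ c (d :: l₂)]
          exact List.perm_append_comm
        have hhead : ((d :: l₂) ++ (l₁ ++ [c])).head? = some d := by simp
        have hlast : ((d :: l₂) ++ (l₁ ++ [c])).getLast? = some c := by
          rw [← List.append_assoc, List.getLast?_append]; rfl
        obtain ⟨l', h1, h2⟩ := key ((d :: l₂) ++ (l₁ ++ [c])) d c
          ⟨hperm.length_eq ▸ hl.three_le, hperm.nodup_iff.2 hl.nodup, by
            refine List.IsChain.append hch.right_of_append hch.left_of_append ?_
            rw [hv2, hu2]
            simpa using hvu.heavyAdj, by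
            rw [hhead, hlast]
            have := hch.rel_getLast_head_of_append
            simpa using this⟩ hhead hlast hcd (by
            have e1 := G.gaps_append l₃ l₄ v u
            rw [h4, h3, List.append_assoc, List.singleton_append, e1, ← h3, ← h4]
            simp only [hvu, hcd, if_true, if_false] at hk hsum ⊢
            omega)
        exact ⟨l', h1, by rw [← hperm.length_eq]; exact h2⟩
    · exact key l u v hl hu hv hvu (by simp only [hvu, if_false] at hk; omega)

theorem exists_cycleList_of_heavy [Fintype V] (G : SimpleGraph V)
    [DecidableRel G.Adj] {l : List V}
    (hl : IsCycleList G.HeavyAdj l) : ∃ l', IsCycleList G.Adj l' ∧ l.length ≤ l'.length := by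
  have hne : l ≠ [] := by
    rintro rfl
    simpa using hl.three_le
  exact G.exists_cycleList_of_heavy_aux _ l _ _ hl (List.head?_eq_some_head hne)
    (List.getLast?_eq_some_getLast hne) le_rfl

theorem isHamiltonian_of_cycleList [Fintype V] [DecidableEq V] (G : SimpleGraph V)
    {l : List V} (hl : IsCycleList G.Adj l) (hmem : ∀ v, v ∈ l) : G.IsHamiltonian := by
  intro _
  have hne : l ≠ [] := by
    rintro rfl
    simpa using hl.three_le
  let p := Walk.ofSupport l hne hl.isChain
  have hsupp : p.support = l := Walk.support_ofSupport hne hl.isChain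
  have hadj : G.Adj (l.getLast hne) (l.head hne) :=
    hl.closing _ (List.getLast?_eq_some_getLast hne) _ (List.head?_eq_some_head hne)
  have hp : p.IsPath := by
    rw [Walk.isPath_def, hsupp]; exact hl.nodup
  have hplen : p.length = l.length - 1 := Walk.length_ofSupport hne hl.isChain
  have hcyc : (Walk.cons hadj p).IsCycle := by
    rw [Walk.cons_isCycle_iff]
    refine ⟨hp, fun he => ?_⟩
    have h1 := hp.length_eq_one_of_mem_edges (Sym2.eq_swap ▸ he)
    have := hl.three_le
    omega
  refine ⟨_, Walk.cons hadj p, ?_⟩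
  rw [Walk.isHamiltonianCycle_isCycle_and_isHamiltonian_tail]
  refine ⟨hcyc, ?_⟩
  intro v
  have : (Walk.cons hadj p).tail.support = l := by
    simpa using hsupp
  rw [this]
  exact List.count_eq_one_of_mem hl.nodup (hmem v)

end SimpleGraph

/-! ### Rerouting a longest cycle through a component `H` of its complement. -/

namespace SimpleGraph

/-- There is an `r`-path from `i` to `j` whose set of vertices is `I`. -/
def PathOn {α : Type*} (r : α → α → Prop) (i j : α) (I : α → Prop) : Prop :=
  ∃ l : List α, l.Nodup ∧ l.IsChain r ∧ l.head? = some i ∧ l.getLast? = some j ∧ ∀ k, k ∈ l ↔ I k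

namespace PathOn

variable {α : Type*} {r : α → α → Prop} {i j i' j' : α} {I J : α → Prop}

theorem single (i : α) : PathOn r i i (fun k => k = i) :=
  ⟨[i], by simp, .singleton i, rfl, rfl, by simp⟩

/-- Reroutings are assembled with this from blocks of consecutive positions, so that disjointness
and covering become linear arithmetic. -/
theorem trans (h : PathOn r i j I) (h' : PathOn r i' j' J) (hr : r j i')
    (hd : ∀ k, I k → J k → False) : PathOn r i j' (fun k => I k ∨ J k) := by
  obtain ⟨l, h1, h2, h3, h4, h5⟩ := h
  obtain ⟨l', h1', h2', h3', h4', h5'⟩ := h'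
  refine ⟨l ++ l', ?_, ?_, ?_, ?_, ?_⟩
  · rw [List.nodup_append]
    refine ⟨h1, h1', ?_⟩
    rintro a ha b hb rfl
    exact hd a ((h5 a).1 ha) ((h5' a).1 hb)
  · refine h2.append h2' ?_
    rw [h4, h3']
    simpa using hr
  · rw [List.head?_append, h3]; rfl
  · rw [List.getLast?_append, h4']; rfl
  · intro k
    rw [List.mem_append, h5, h5']

theorem symm (hr : ∀ a b, r a b → r b a) (h : PathOn r i j I) : PathOn r j i I := by
  obtain ⟨l, h1, h2, h3, h4, h5⟩ := h
  refine ⟨l.reverse, List.nodup_reverse.2 h1, ?_, ?_, ?_, ?_⟩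
  · rw [List.isChain_reverse]
    exact h2.imp fun a b h => hr _ _ h
  · rw [List.head?_reverse, h4]
  · rw [List.getLast?_reverse, h3]
  · simpa using h5

theorem congr (h : PathOn r i j I) (hI : ∀ k, I k ↔ J k) : PathOn r i j J := by
  obtain ⟨l, h1, h2, h3, h4, h5⟩ := h
  exact ⟨l, h1, h2, h3, h4, fun k => (h5 k).trans (hI k)⟩

theorem interval {r : ℕ → ℕ → Prop} (hr : ∀ k, r k (k + 1)) {i j : ℕ} (hij : i ≤ j) :
    PathOn r i j (fun k => i ≤ k ∧ k ≤ j) := by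
  induction j, hij using Nat.le_induction with
  | base => exact (single i).congr fun k => by omega
  | succ j hij ih =>
    refine (ih.trans (single (j + 1)) (hr j) (by intro k; omega)).congr fun k => ?_
    omega

end PathOn

variable {V : Type*} [Fintype V]

theorem IsClawHeavy.heavyAdj {G : SimpleGraph V} [DecidableRel G.Adj] (hG : G.IsClawHeavy)
    {c x y z : V} (hx : G.Adj c x) (hy : G.Adj c y) (hz : G.Adj c z) (hxy : x ≠ y) (hxz : x ≠ z)
    (hyz : y ≠ z) : G.HeavyAdj x y ∨ G.HeavyAdj x z ∨ G.HeavyAdj y z := by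
  by_cases h1 : G.Adj x y
  · exact Or.inl h1.heavyAdj
  by_cases h2 : G.Adj x z
  · exact Or.inr (Or.inl h2.heavyAdj)
  by_cases h3 : G.Adj y z
  · exact Or.inr (Or.inr h3.heavyAdj)
  rcases hG c x y z ⟨hx, hy, hz, hxy, hxz, hyz, h1, h2, h3⟩ with h | h | h
  · exact Or.inl (Or.inr h)
  · exact Or.inr (Or.inl (Or.inr h))
  · exact Or.inr (Or.inr (Or.inr h))

/-- A longest cycle of a claw-heavy graph, listed periodically by `f`, together with a component
`H` of the graph left after removing it. -/
structure LongestCycle (G : SimpleGraph V) [DecidableRel G.Adj] (f : ℕ → V) (m : ℕ) (H : Set V) :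
    Prop where
  clawHeavy : G.IsClawHeavy
  three_le : 3 ≤ m
  periodic : ∀ i, f (i + m) = f i
  adj : ∀ i, G.Adj (f i) (f (i + 1))
  inj : ∀ i j, f i = f j → i ≡ j [MOD m]
  length_le : ∀ l : List V, IsCycleList G.Adj l → l.length ≤ m
  notMem : ∀ i, f i ∉ H
  closed : ∀ u ∈ H, ∀ v, G.Adj u v → v ∈ H ∨ ∃ i, f i = v
  path : ∀ u ∈ H, ∀ v ∈ H, ∃ I, PathOn G.Adj u v I ∧ ∀ w, I w → w ∈ H

/-- The `i`-th vertex of the enumeration `f` has a neighbour in `H`. -/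
def Attached (G : SimpleGraph V) (f : ℕ → V) (H : Set V) (i : ℕ) : Prop :=
  ∃ h ∈ H, G.Adj (f i) h

namespace LongestCycle

variable {G : SimpleGraph V} [DecidableRel G.Adj] {f : ℕ → V} {m : ℕ} {H : Set V}

theorem eq_of_window (C : G.LongestCycle f m H) (s : ℕ) {i j : ℕ} (h : f i = f j) (hi : s < i)
    (hi' : i ≤ s + m) (hj : s < j) (hj' : j ≤ s + m) : i = j := by
  wlog hij : i ≤ j generalizing i j
  · exact (this h.symm hj hj' hi hi' (by omega)).symm
  have h1 := (Nat.modEq_iff_dvd' hij).1 (C.inj i j h)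
  have h2 := Nat.eq_zero_of_dvd_of_lt h1 (by omega)
  omega

theorem ne_of_lt (C : G.LongestCycle f m H) {i j : ℕ} (h : i < j) (h' : j < i + m) : f i ≠ f j := by
  intro e
  have h1 := (Nat.modEq_iff_dvd' h.le).1 (C.inj i j e)
  have h2 := Nat.eq_zero_of_dvd_of_lt h1 (by omega)
  omega

theorem attached_add (C : G.LongestCycle f m H) (i : ℕ) :
    G.Attached f H (i + m) ↔ G.Attached f H i := by
  rw [Attached, Attached, C.periodic]

theorem up (C : G.LongestCycle f m H) {i j : ℕ} (h : i ≤ j) :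
    PathOn (fun k l => G.HeavyAdj (f k) (f l)) i j (fun k => i ≤ k ∧ k ≤ j) :=
  PathOn.interval (fun k => (C.adj k).heavyAdj) h

theorem down (C : G.LongestCycle f m H) {i j : ℕ} (h : i ≤ j) :
    PathOn (fun k l => G.HeavyAdj (f k) (f l)) j i (fun k => i ≤ k ∧ k ≤ j) :=
  (C.up h).symm fun _ _ h => h.symm

/-- The vertices of the cycle carry no heavy path between two vertices both of which see `H`. -/
theorem no_path (C : G.LongestCycle f m H) {i j : ℕ} {I : ℕ → Prop} (s : ℕ)
    (hp : PathOn (fun k l => G.HeavyAdj (f k) (f l)) i j I) (hI : ∀ k, I k ↔ s < k ∧ k ≤ s + m)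
    {u v : V} (hu : u ∈ H) (hv : v ∈ H) (hiu : G.HeavyAdj (f i) u) (hjv : G.HeavyAdj (f j) v) :
    False := by
  obtain ⟨l, h1, h2, h3, h4, h5⟩ := hp
  obtain ⟨J, ⟨l', h1', h2', h3', h4', h5'⟩, hJ⟩ := C.path v hv u hu
  have hlen : l.length = m := by
    rw [← List.toFinset_card_of_nodup h1]
    have : l.toFinset = Finset.Ioc s (s + m) := by
      ext k; simp [h5, hI]
    rw [this]; simp
  have hlen' : 0 < l'.length := by
    rcases l' with _ | ⟨a, l'⟩
    · simp at h3'
    · simp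
  have hm := C.three_le
  have hcyc : IsCycleList G.HeavyAdj (l.map f ++ l') := by
    refine ⟨by simp; omega, ?_, ?_, ?_⟩
    · rw [List.nodup_append]
      refine ⟨?_, h1', ?_⟩
      · refine List.Nodup.map_on ?_ h1
        intro x hx y hy hxy
        rw [h5, hI] at hx hy
        exact C.eq_of_window s hxy hx.1 hx.2 hy.1 hy.2
      · rintro a ha b hb rfl
        obtain ⟨k, -, rfl⟩ := List.mem_map.1 ha
        exact C.notMem k (hJ _ ((h5' _).1 hb))
    · refine List.IsChain.append ?_ (h2'.imp fun a b h => h.heavyAdj) ?_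
      · rw [List.isChain_map]; exact h2
      · rw [List.getLast?_map, h4, h3']
        simpa using hjv
    · rw [List.getLast?_append, h4', List.head?_append, List.head?_map, h3]
      simpa using hiu.symm
  obtain ⟨l'', h6, h7⟩ := G.exists_cycleList_of_heavy hcyc
  have := C.length_le _ h6
  simp at h7
  omega

theorem not_heavyAdj_succ (C : G.LongestCycle f m H) {i : ℕ} (hi : G.Attached f H i) {h : V}
    (hh : h ∈ H) : ¬ G.HeavyAdj (f (i + 1)) h := by
  intro hc
  obtain ⟨u, hu, hiu⟩ := hi
  have hm := C.three_le
  refine C.no_path i (C.up (i := i + 1) (j := i + m) (by omega)) (by intro k; omega) hh hu hc ?_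
  rw [C.periodic]; exact hiu.heavyAdj

theorem not_attached_succ (C : G.LongestCycle f m H) {i : ℕ} (hi : G.Attached f H i) :
    ¬ G.Attached f H (i + 1) := by
  rintro ⟨h, hh, hadj⟩
  exact C.not_heavyAdj_succ hi hh hadj.heavyAdj

/-- The successors of two vertices seeing `H` are not joined. -/
theorem not_heavyAdj_succ_succ (C : G.LongestCycle f m H) {i j : ℕ} (hij : i < j) (hj : j < i + m)
    {u v : V} (hu : u ∈ H) (hv : v ∈ H) (hiu : G.HeavyAdj (f i) u) (hjv : G.HeavyAdj (f j) v) :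
    ¬ G.HeavyAdj (f (i + 1)) (f (j + 1)) := by
  intro hc
  -- Only heavy pairs towards `H` are needed here; the degree count below applies this to a position
  -- not yet known to be unjoined to `H`.
  refine C.no_path i ((C.down (i := i + 1) (j := j) (by omega)).trans
    (C.up (i := j + 1) (j := i + m) (by omega)) hc (by intro k; omega)) (by intro k; omega)
    hv hu hjv ?_
  rw [C.periodic]; exact hiu

theorem not_heavyAdj_succ_succ_of_ne (C : G.LongestCycle f m H) {i j : ℕ} (hij : i ≠ j) (hi : i < m)
    (hj : j < m) {u v : V} (hu : u ∈ H) (hv : v ∈ H) (hiu : G.HeavyAdj (f i) u)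
    (hjv : G.HeavyAdj (f j) v) : ¬ G.HeavyAdj (f (i + 1)) (f (j + 1)) := by
  rcases Nat.lt_or_gt_of_ne hij with h | h
  · exact C.not_heavyAdj_succ_succ h (by omega) hu hv hiu hjv
  · intro hc
    exact C.not_heavyAdj_succ_succ h (by omega) hv hu hjv hiu hc.symm

/-- A vertex of the cycle without neighbours in `H` has small degree sum with the vertices
of `H`. -/
theorem not_heavyAdj_of_not_attached (C : G.LongestCycle f m H) {w : ℕ} (hw : ¬ G.Attached f H w)
    {h : V} (hh : h ∈ H) : ¬ G.HeavyAdj (f w) h := by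
  classical
  have hm := C.three_le
  have hmod : ∀ i, f (i % m) = f i := fun i =>
    (show Function.Periodic f m from C.periodic).map_mod_nat i
  wlog hwm : w < m generalizing w
  · rw [← hmod w]
    refine this ?_ (Nat.mod_lt _ (by omega))
    rwa [Attached, hmod w]
  intro hc
  have hnadj : ¬ G.Adj (f w) h := fun hadj => hw ⟨h, hh, hadj⟩
  rcases hc with hc' | hdeg
  · exact hnadj hc'
  have hc : G.HeavyAdj (f w) h := Or.inr hdeg
  set A := (Finset.range m).filter (fun i => G.Attached f H i) with hA
  have memA : ∀ i, i ∈ A ↔ i < m ∧ G.Attached f H i := by simp [hA]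
  set HF := H.toFinite.toFinset with hHF
  have memH : ∀ v, v ∈ HF ↔ v ∈ H := by simp [hHF]
  set P := A.image (fun i => f (i + 1)) with hP
  have hcardP : P.card = A.card := by
    refine Finset.card_image_of_injOn ?_
    intro i hi j hj hij
    have h1 := (memA i).1 hi
    have h2 := (memA j).1 hj
    have := C.eq_of_window 0 hij (by omega) (by omega) (by omega) (by omega)
    omega
  have hsub : G.neighborFinset h ⊆ HF.erase h ∪ A.image f := by
    intro v hv
    rw [mem_neighborFinset] at hv
    rw [Finset.mem_union, Finset.mem_erase, memH, Finset.mem_image]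
    rcases C.closed h hh v hv with h1 | ⟨i, rfl⟩
    · exact Or.inl ⟨hv.ne', h1⟩
    · refine Or.inr ⟨i % m, ?_, hmod i⟩
      rw [memA, Attached, hmod]
      exact ⟨Nat.mod_lt _ (by omega), h, hh, hv.symm⟩
  have hd1 : G.degree h ≤ (HF.card - 1) + A.card := by
    rw [← card_neighborFinset_eq_degree]
    refine (Finset.card_le_card hsub).trans ((Finset.card_union_le _ _).trans ?_)
    rw [Finset.card_erase_of_mem ((memH h).2 hh)]
    exact Nat.add_le_add_left Finset.card_image_le _
  have hHpos : 0 < HF.card := Finset.card_pos.2 ⟨h, (memH h).2 hh⟩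
  -- Two neighbours in `P`, together with `f (w + 1)`, would be three successors of positions joined
  -- to `H`. They are pairwise unjoined, against claw-heaviness at `f w`.
  have hone : (G.neighborFinset (f w) ∩ P).card ≤ 1 := by
    rw [Finset.card_le_one]
    intro x hx y hy
    rw [Finset.mem_inter, mem_neighborFinset, hP, Finset.mem_image] at hx hy
    obtain ⟨hx, i, hi, rfl⟩ := hx
    obtain ⟨hy, j, hj, rfl⟩ := hy
    rw [memA] at hi hj
    by_contra hne
    obtain ⟨him, u, hu, hiu⟩ := hi
    obtain ⟨hjm, v, hv, hjv⟩ := hj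
    have hij : i ≠ j := by rintro rfl; exact hne rfl
    have hiw : i ≠ w := by rintro rfl; exact hw ⟨u, hu, hiu⟩
    have hjw : j ≠ w := by rintro rfl; exact hw ⟨v, hv, hjv⟩
    have hne' : ∀ k l, k ≠ l → k < m → l < m → f (k + 1) ≠ f (l + 1) := by
      intro k l hkl hk hl e
      have := C.eq_of_window 0 e (by omega) (by omega) (by omega) (by omega)
      omega
    rcases C.clawHeavy.heavyAdj hx hy (C.adj w) hne (hne' _ _ hiw him hwm) (hne' _ _ hjw hjm hwm)
      with h1 | h1 | h1
    · exact C.not_heavyAdj_succ_succ_of_ne hij him hjm hu hv hiu.heavyAdj hjv.heavyAdj h1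
    · exact C.not_heavyAdj_succ_succ_of_ne hiw him hwm hu hh hiu.heavyAdj hc h1
    · exact C.not_heavyAdj_succ_succ_of_ne hjw hjm hwm hv hh hjv.heavyAdj hc h1
  have hdisj : Disjoint (G.neighborFinset (f w) ∪ P) (insert (f w) HF) := by
    rw [Finset.disjoint_right]
    intro v hv
    rw [Finset.mem_insert, memH] at hv
    rw [Finset.mem_union, mem_neighborFinset, hP, Finset.mem_image]
    rintro (h1 | ⟨i, hi, rfl⟩)
    · rcases hv with rfl | hv
      · exact G.irrefl h1
      · exact hw ⟨v, hv, h1⟩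
    · rw [memA] at hi
      rcases hv with h1 | hv
      · exact C.not_heavyAdj_succ hi.2 hh (h1 ▸ hc)
      · exact C.notMem _ hv
  -- This gives `deg (f w) + |A| - 1 + |H| + 1 ≤ n`, while `deg h ≤ |H| - 1 + |A|`; hence the degree
  -- sum is below `n`.
  have hle := Finset.card_le_univ ((G.neighborFinset (f w) ∪ P) ∪ insert (f w) HF)
  rw [Finset.card_union_of_disjoint hdisj, Finset.card_insert_of_notMem
    (by rw [memH]; exact C.notMem w)] at hle
  have h1 := Finset.card_union_add_card_inter (G.neighborFinset (f w)) P
  rw [card_neighborFinset_eq_degree, hcardP] at h1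
  omega

/-- The neighbours on the cycle of a vertex attached to `H` that do not see `H` are pairwise
joined. -/
theorem heavyAdj_of_common (C : G.LongestCycle f m H) {v i j : ℕ} (hv : G.Attached f H v)
    (hi : ¬ G.Attached f H i) (hj : ¬ G.Attached f H j) (hvi : G.Adj (f v) (f i))
    (hvj : G.Adj (f v) (f j)) (hij : f i ≠ f j) : G.HeavyAdj (f i) (f j) := by
  obtain ⟨h, hh, hvh⟩ := hv
  rcases C.clawHeavy.heavyAdj hvi hvj hvh hij (fun e => C.notMem i (e ▸ hh))
    (fun e => C.notMem j (e ▸ hh)) with h1 | h1 | h1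
  · exact h1
  · exact absurd h1 (C.not_heavyAdj_of_not_attached hi hh)
  · exact absurd h1 (C.not_heavyAdj_of_not_attached hj hh)

/-- The cycle neighbours of an attached vertex are unattached, hence joined. An attached vertex can
therefore be cut out of the cycle and visited elsewhere. -/
theorem heavyAdj_pred_succ (C : G.LongestCycle f m H) {i : ℕ} (hi : G.Attached f H (i + 1)) :
    G.HeavyAdj (f i) (f (i + 2)) := by
  have hm := C.three_le
  refine C.heavyAdj_of_common hi ?_ (C.not_attached_succ hi) (C.adj i).symm (C.adj (i + 1))
    (C.ne_of_lt (by omega) (by omega))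
  intro h
  exact C.not_attached_succ h hi

theorem not_heavyAdj_attached_succ (C : G.LongestCycle f m H) {i j : ℕ} (hi : G.Attached f H i)
    (hj : G.Attached f H j) (hij : i < j) (hjm : j < i + m) : ¬ G.HeavyAdj (f j) (f (i + 1)) := by
  intro hc
  have hne : j ≠ i + 1 := by rintro rfl; exact C.not_attached_succ hi hj
  have h1 : G.HeavyAdj (f (j - 1)) (f (j + 1)) := by
    have := C.heavyAdj_pred_succ (i := j - 1) (by rwa [Nat.sub_add_cancel (by omega)])
    rwa [show j - 1 + 2 = j + 1 by omega] at this
  obtain ⟨u, hu, hiu⟩ := hi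
  obtain ⟨v, hv, hjv⟩ := hj
  refine C.no_path i (((PathOn.single j).trans (C.up (i := i + 1) (j := j - 1) (by omega)) hc
    (by intro k; omega)).trans (C.up (i := j + 1) (j := i + m) (by omega)) h1 (by intro k; omega))
    (by intro k; omega) hv hu hjv.heavyAdj ?_
  rw [C.periodic]; exact hiu.heavyAdj

/-- The previous statement with the roles exchanged, after moving `i` forward by one period. -/
theorem not_heavyAdj_attached_succ' (C : G.LongestCycle f m H) {i j : ℕ} (hi : G.Attached f H i)
    (hj : G.Attached f H j) (hij : i < j) (hjm : j < i + m) : ¬ G.HeavyAdj (f i) (f (j + 1)) := by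
  rw [← C.periodic i]
  exact C.not_heavyAdj_attached_succ hj ((C.attached_add i).2 hi) hjm (by omega)

end LongestCycle
end SimpleGraph

/-! ### Rungs: forced and forbidden pairs. -/

namespace SimpleGraph

/-- Positions `a < b` are consecutive among those attached to `H`, and `f q` is a common neighbour
of `f (a + 1)` and `f b` strictly between them. -/
structure Rung {V : Type*} (G : SimpleGraph V) (f : ℕ → V) (m : ℕ) (H : Set V) (a b q : ℕ) :
    Prop where
  left : G.Attached f H a
  right : G.Attached f H b
  lt_add : b < a + m
  between : ∀ k, a < k → k < b → ¬ G.Attached f H k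
  lt_mid : a + 1 < q
  mid_lt : q < b
  adj_left : G.Adj (f (a + 1)) (f q)
  adj_right : G.Adj (f q) (f b)

namespace Rung

theorem not_attached_mid {V : Type*} {G : SimpleGraph V} {f : ℕ → V} {m : ℕ} {H : Set V}
    {a b q : ℕ} (R : G.Rung f m H a b q) : ¬ G.Attached f H q :=
  R.between q (by have := R.lt_mid; omega) R.mid_lt

variable {V : Type*} [Fintype V] {G : SimpleGraph V} [DecidableRel G.Adj] {f : ℕ → V} {m : ℕ}
  {H : Set V} {a b q : ℕ}

/-- Both `b` and `a + m` are attached. Most exclusions below reroute the cycle from `b` to `a + m`.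
-/
theorem no_path (R : G.Rung f m H a b q) (C : G.LongestCycle f m H) {I : ℕ → Prop}
    (hp : PathOn (fun k l => G.HeavyAdj (f k) (f l)) b (a + m) I)
    (hI : ∀ k, I k ↔ a < k ∧ k ≤ a + m) : False := by
  obtain ⟨u, hu, hau⟩ := R.left
  obtain ⟨v, hv, hbv⟩ := R.right
  refine C.no_path a hp hI hv hu hbv.heavyAdj ?_
  rw [C.periodic]; exact hau.heavyAdj

theorem not_attached_succ_right (R : G.Rung f m H a b q) (C : G.LongestCycle f m H) :
    ¬ G.Attached f H (b + 1) :=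
  C.not_attached_succ R.right

theorem succ_right_lt (R : G.Rung f m H a b q) (C : G.LongestCycle f m H) : b + 1 < a + m := by
  have h1 := R.lt_add
  by_contra h
  have h2 : b + 1 = a + m := by omega
  refine R.not_attached_succ_right C ?_
  rw [h2, C.attached_add]; exact R.left

theorem heavyAdj_pred_succ_right (R : G.Rung f m H a b q) (C : G.LongestCycle f m H) :
    G.HeavyAdj (f (b - 1)) (f (b + 1)) := by
  have h1 := R.lt_mid
  have h2 := R.mid_lt
  have := C.heavyAdj_pred_succ (i := b - 1)
    (by rw [Nat.sub_add_cancel (by omega)]; exact R.right)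
  rwa [show b - 1 + 2 = b + 1 by omega] at this

theorem heavyAdj_pred_succ_left (R : G.Rung f m H a b q) (C : G.LongestCycle f m H) :
    G.HeavyAdj (f (a + m - 1)) (f (a + 1)) := by
  have h0 := C.three_le
  have := C.heavyAdj_pred_succ (i := a + m - 1)
    (by rw [Nat.sub_add_cancel (by omega), C.attached_add]; exact R.left)
  rwa [show a + m - 1 + 2 = a + 1 + m by omega, C.periodic] at this

theorem heavyAdj_left_last (_R : G.Rung f m H a b q) (C : G.LongestCycle f m H) :
    G.HeavyAdj (f (a + 1)) (f (a + m)) := by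
  rw [C.periodic]; exact (C.adj a).symm.heavyAdj

theorem heavyAdj_mid_succ_right (R : G.Rung f m H a b q) (C : G.LongestCycle f m H) :
    G.HeavyAdj (f q) (f (b + 1)) := by
  have h1 := R.lt_mid
  have h2 := R.mid_lt
  have h3 := R.succ_right_lt C
  exact C.heavyAdj_of_common R.right R.not_attached_mid (R.not_attached_succ_right C)
    R.adj_right.symm (C.adj b) (C.ne_of_lt (by omega) (by omega))

theorem succ_lt_mid (R : G.Rung f m H a b q) (C : G.LongestCycle f m H) : a + 2 < q := by
  have h1 := R.lt_mid
  have h2 := R.mid_lt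
  have h3 := R.succ_right_lt C
  by_contra h
  obtain rfl : q = a + 2 := by omega
  refine R.no_path C ((((C.down (i := a + 2) (j := b) (by omega)).trans
    (C.up (i := b + 1) (j := a + m - 1) (by omega)) (R.heavyAdj_mid_succ_right C)
    (by intro k; omega)).trans (PathOn.single (a + 1)) (R.heavyAdj_pred_succ_left C)
    (by intro k; omega)).trans (PathOn.single (a + m)) (R.heavyAdj_left_last C)
    (by intro k; omega)) (by intro k; omega)

theorem not_heavyAdj_pred_mid_right (R : G.Rung f m H a b q) (C : G.LongestCycle f m H) :
    ¬ G.HeavyAdj (f (q - 1)) (f b) := by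
  intro hc
  have h1 := R.lt_mid
  have h2 := R.mid_lt
  have h3 := R.succ_right_lt C
  exact R.no_path C ((((PathOn.single b).trans (C.down (i := a + 1) (j := q - 1) (by omega))
    hc.symm (by intro k; omega)).trans (C.up (i := q) (j := b - 1) (by omega)) R.adj_left.heavyAdj
    (by intro k; omega)).trans (C.up (i := b + 1) (j := a + m) (by omega))
    (R.heavyAdj_pred_succ_right C) (by intro k; omega)) (by intro k; omega)

theorem not_heavyAdj_pred_succ_mid (R : G.Rung f m H a b q) (C : G.LongestCycle f m H)
    (hq : q + 1 < b) : ¬ G.HeavyAdj (f (q - 1)) (f (q + 1)) := by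
  intro hc
  have h1 := R.lt_mid
  have h3 := R.succ_right_lt C
  exact R.no_path C (((((PathOn.single b).trans (PathOn.single q) R.adj_right.symm.heavyAdj
    (by intro k; omega)).trans (C.up (i := a + 1) (j := q - 1) (by omega))
    R.adj_left.symm.heavyAdj (by intro k; omega)).trans
    (C.up (i := q + 1) (j := b - 1) (by omega)) hc (by intro k; omega)).trans
    (C.up (i := b + 1) (j := a + m) (by omega))
    (R.heavyAdj_pred_succ_right C) (by intro k; omega)) (by intro k; omega)

/-- Among the neighbours `f (q - 1)`, `f (q + 1)`, `f b` of `f q`, reroutings exclude the other two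
pairs. -/
theorem heavyAdj_succ_mid_right (R : G.Rung f m H a b q) (C : G.LongestCycle f m H)
    (hq : q + 1 < b) : G.HeavyAdj (f (q + 1)) (f b) := by
  have h0 := C.three_le
  have h1 := R.lt_mid
  have h3 := R.succ_right_lt C
  have e : q - 1 + 1 = q := by omega
  have hadj : G.Adj (f q) (f (q - 1)) := by
    have := C.adj (q - 1)
    rw [e] at this
    exact this.symm
  rcases C.clawHeavy.heavyAdj hadj (C.adj q) R.adj_right (C.ne_of_lt (by omega) (by omega))
    (C.ne_of_lt (by omega) (by omega)) (C.ne_of_lt (by omega) (by omega)) with h | h | h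
  · exact absurd h (R.not_heavyAdj_pred_succ_mid C hq)
  · exact absurd h (R.not_heavyAdj_pred_mid_right C)
  · exact h

/-- The stretch between `q` and `b` can be traversed starting from `b` so that its other end is
joined to the successor of `b`. -/
theorem exists_flip (R : G.Rung f m H a b q) (C : G.LongestCycle f m H) :
    ∃ e, PathOn (fun k l => G.HeavyAdj (f k) (f l)) b e (fun k => q < k ∧ k ≤ b) ∧
      G.HeavyAdj (f e) (f (b + 1)) := by
  have h2 := R.mid_lt
  by_cases hq : q + 1 < b
  · refine ⟨b - 1, ((PathOn.single b).trans (C.up (i := q + 1) (j := b - 1) (by omega))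
      (R.heavyAdj_succ_mid_right C hq).symm (by intro k; omega)).congr (by intro k; omega),
      R.heavyAdj_pred_succ_right C⟩
  · exact ⟨b, (PathOn.single b).congr (by intro k; omega), (C.adj b).heavyAdj⟩

theorem not_heavyAdj_left_two (R : G.Rung f m H a b q) (C : G.LongestCycle f m H) :
    ¬ G.HeavyAdj (f a) (f (a + 2)) := by
  intro hc
  have h1 := R.lt_mid
  have h1' := R.succ_lt_mid C
  have h2 := R.mid_lt
  have h3 := R.succ_right_lt C
  obtain ⟨e, hp, he⟩ := R.exists_flip C
  exact R.no_path C ((((hp.trans (C.up (i := b + 1) (j := a + m - 1) (by omega)) he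
    (by intro k; omega)).trans (PathOn.single (a + 1)) (R.heavyAdj_pred_succ_left C)
    (by intro k; omega)).trans (C.down (i := a + 2) (j := q) (by omega)) R.adj_left.heavyAdj
    (by intro k; omega)).trans (PathOn.single (a + m)) (by rw [C.periodic]; exact hc.symm)
    (by intro k; omega)) (by intro k; omega)

theorem not_heavyAdj_left_mid (R : G.Rung f m H a b q) (C : G.LongestCycle f m H) :
    ¬ G.HeavyAdj (f a) (f q) := by
  intro hc
  have h1 := R.lt_mid
  have h2 := R.mid_lt
  have h3 := R.succ_right_lt C
  obtain ⟨e, hp, he⟩ := R.exists_flip C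
  exact R.no_path C (((hp.trans (C.up (i := b + 1) (j := a + m - 1) (by omega)) he
    (by intro k; omega)).trans (C.up (i := a + 1) (j := q) (by omega))
    (R.heavyAdj_pred_succ_left C)
    (by intro k; omega)).trans (PathOn.single (a + m)) (by rw [C.periodic]; exact hc.symm)
    (by intro k; omega)) (by intro k; omega)

/-- Claw-heaviness at `f (a + 1)`: the two pairs containing `f a` are excluded. -/
theorem heavyAdj_two_mid (R : G.Rung f m H a b q) (C : G.LongestCycle f m H) :
    G.HeavyAdj (f (a + 2)) (f q) := by
  have h0 := C.three_le
  have h1 := R.succ_lt_mid C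
  have h2 := R.mid_lt
  have h3 := R.succ_right_lt C
  rcases C.clawHeavy.heavyAdj (C.adj a).symm (C.adj (a + 1)) R.adj_left
    (C.ne_of_lt (by omega) (by omega)) (C.ne_of_lt (by omega) (by omega))
    (C.ne_of_lt (by omega) (by omega)) with h | h | h
  · exact absurd h (R.not_heavyAdj_left_two C)
  · exact absurd h (R.not_heavyAdj_left_mid C)
  · exact h

/-- This and the following exclusions supply non-edges of the final long paths. -/
theorem not_heavyAdj_two_right (R : G.Rung f m H a b q) (C : G.LongestCycle f m H) :
    ¬ G.HeavyAdj (f (a + 2)) (f b) := by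
  intro hc
  have h1 := R.succ_lt_mid C
  have h2 := R.mid_lt
  have h3 := R.succ_right_lt C
  exact R.no_path C (((((PathOn.single b).trans (C.up (i := a + 2) (j := b - 1) (by omega))
    hc.symm (by intro k; omega)).trans (C.up (i := b + 1) (j := a + m - 1) (by omega))
    (R.heavyAdj_pred_succ_right C) (by intro k; omega)).trans (PathOn.single (a + 1))
    (R.heavyAdj_pred_succ_left C) (by intro k; omega)).trans (PathOn.single (a + m))
    (R.heavyAdj_left_last C) (by intro k; omega)) (by intro k; omega)

theorem not_heavyAdj_one_right (R : G.Rung f m H a b q) (C : G.LongestCycle f m H) :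
    ¬ G.HeavyAdj (f (a + 1)) (f b) := by
  have h1 := R.lt_mid
  have h2 := R.mid_lt
  exact fun h => C.not_heavyAdj_attached_succ R.left R.right (by omega) R.lt_add h.symm

theorem not_heavyAdj_left_succ_right (R : G.Rung f m H a b q) (C : G.LongestCycle f m H) :
    ¬ G.HeavyAdj (f a) (f (b + 1)) := by
  have h1 := R.lt_mid
  have h2 := R.mid_lt
  exact C.not_heavyAdj_attached_succ' R.left R.right (by omega) R.lt_add

theorem not_heavyAdj_one_succ_right (R : G.Rung f m H a b q) (C : G.LongestCycle f m H) :
    ¬ G.HeavyAdj (f (a + 1)) (f (b + 1)) := by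
  have h1 := R.lt_mid
  have h2 := R.mid_lt
  obtain ⟨u, hu, hau⟩ := R.left
  obtain ⟨v, hv, hbv⟩ := R.right
  exact C.not_heavyAdj_succ_succ (by omega) R.lt_add hu hv hau.heavyAdj hbv.heavyAdj

theorem not_heavyAdj_two_succ_right (R : G.Rung f m H a b q) (C : G.LongestCycle f m H) :
    ¬ G.HeavyAdj (f (a + 2)) (f (b + 1)) := by
  intro hc
  have h1 := R.succ_lt_mid C
  have h2 := R.mid_lt
  have h3 := R.succ_right_lt C
  exact R.no_path C ((((C.down (i := a + 2) (j := b) (by omega)).trans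
    (C.up (i := b + 1) (j := a + m - 1) (by omega)) hc
    (by intro k; omega)).trans (PathOn.single (a + 1)) (R.heavyAdj_pred_succ_left C)
    (by intro k; omega)).trans (PathOn.single (a + m)) (R.heavyAdj_left_last C)
    (by intro k; omega)) (by intro k; omega)

theorem not_heavyAdj_two_two (R : G.Rung f m H a b q) (C : G.LongestCycle f m H)
    (hb : b + 2 < a + m) : ¬ G.HeavyAdj (f (a + 2)) (f (b + 2)) := by
  intro hc
  have h1 := R.succ_lt_mid C
  have h2 := R.mid_lt
  exact R.no_path C (((((C.up (i := b) (j := b + 1) (by omega)).trans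
    (C.down (i := a + 2) (j := b - 1) (by omega)) (R.heavyAdj_pred_succ_right C).symm
    (by intro k; omega)).trans (C.up (i := b + 2) (j := a + m - 1) (by omega)) hc
    (by intro k; omega)).trans (PathOn.single (a + 1)) (R.heavyAdj_pred_succ_left C)
    (by intro k; omega)).trans (PathOn.single (a + m)) (R.heavyAdj_left_last C)
    (by intro k; omega)) (by intro k; omega)

theorem not_heavyAdj_one_two (R : G.Rung f m H a b q) (C : G.LongestCycle f m H)
    (hb : b + 2 < a + m) : ¬ G.HeavyAdj (f (a + 1)) (f (b + 2)) := by
  intro hc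
  have h1 := R.succ_lt_mid C
  have h2 := R.mid_lt
  exact R.no_path C (((C.up (i := b) (j := b + 1) (by omega)).trans
    (C.down (i := a + 1) (j := b - 1) (by omega)) (R.heavyAdj_pred_succ_right C).symm
    (by intro k; omega)).trans (C.up (i := b + 2) (j := a + m) (by omega)) hc
    (by intro k; omega)) (by intro k; omega)

theorem not_heavyAdj_pred_mid_two (R : G.Rung f m H a b q) (C : G.LongestCycle f m H)
    (hb : b + 2 < a + m) : ¬ G.HeavyAdj (f (q - 1)) (f (b + 2)) := by
  intro hc
  have h1 := R.succ_lt_mid C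
  have h2 := R.mid_lt
  exact R.no_path C ((((C.up (i := b) (j := b + 1) (by omega)).trans
    (C.down (i := q) (j := b - 1) (by omega)) (R.heavyAdj_pred_succ_right C).symm
    (by intro k; omega)).trans (C.up (i := a + 1) (j := q - 1) (by omega))
    R.adj_left.symm.heavyAdj (by intro k; omega)).trans
    (C.up (i := b + 2) (j := a + m) (by omega)) hc
    (by intro k; omega)) (by intro k; omega)

section TwoRungs

variable {s q' : ℕ}

/-- The flip at the far end `s + m` of the second rung, read backwards. -/
theorem exists_flip_reverse (R' : G.Rung f m H b (s + m) q') (C : G.LongestCycle f m H) :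
    ∃ e, PathOn (fun k l => G.HeavyAdj (f k) (f l)) e (s + m) (fun k => q' < k ∧ k ≤ s + m) ∧
      G.HeavyAdj (f (s + 1)) (f e) := by
  obtain ⟨e, hp, he⟩ := R'.exists_flip C
  refine ⟨e, hp.symm fun _ _ h => h.symm, ?_⟩
  rw [show s + m + 1 = s + 1 + m by omega, C.periodic] at he
  exact he.symm

/-- The cycle is now cut just after `s`, the second rung's far end one period back. With `s ≤ a` the
window contains both stretches; `s = a` occurs when only two vertices are attached. -/
theorem no_path_next (R' : G.Rung f m H b (s + m) q') (C : G.LongestCycle f m H) {I : ℕ → Prop}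
    (hp : PathOn (fun k l => G.HeavyAdj (f k) (f l)) b (s + m) I)
    (hI : ∀ k, I k ↔ s < k ∧ k ≤ s + m) : False := by
  obtain ⟨u, hu, hbu⟩ := R'.left
  obtain ⟨v, hv, hdv⟩ := R'.right
  exact C.no_path s hp hI hu hv hbu.heavyAdj hdv.heavyAdj

theorem not_heavyAdj_mid_two_next (R : G.Rung f m H a b q) (R' : G.Rung f m H b (s + m) q')
    (C : G.LongestCycle f m H) (hs : s ≤ a) : ¬ G.HeavyAdj (f q) (f (b + 2)) := by
  intro hc
  have h1 := R.succ_lt_mid C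
  have h2 := R.mid_lt
  have h1' := R'.succ_lt_mid C
  have h2' := R'.mid_lt
  obtain ⟨e, hp, he⟩ := R.exists_flip C
  obtain ⟨e', hp', he'⟩ := R'.exists_flip_reverse C
  exact R'.no_path_next C ((((hp.trans (PathOn.single (b + 1)) he (by intro k; omega)).trans
    (C.down (i := b + 2) (j := q') (by omega)) R'.adj_left.heavyAdj (by intro k; omega)).trans
    (C.down (i := s + 1) (j := q) (by omega)) hc.symm (by intro k; omega)).trans hp' he'
    (by intro k; omega)) (by intro k; omega)

theorem not_heavyAdj_pred_mid_mid (R : G.Rung f m H a b q) (R' : G.Rung f m H b (s + m) q')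
    (C : G.LongestCycle f m H) (hs : s ≤ a) : ¬ G.HeavyAdj (f (q - 1)) (f q') := by
  intro hc
  have h1 := R.succ_lt_mid C
  have h2 := R.mid_lt
  have h1' := R'.succ_lt_mid C
  have h2' := R'.mid_lt
  obtain ⟨e', hp', he'⟩ := R'.exists_flip_reverse C
  exact R'.no_path_next C (((((PathOn.single b).trans (C.up (i := q) (j := b - 1) (by omega))
    R.adj_right.symm.heavyAdj (by intro k; omega)).trans
    (C.up (i := b + 1) (j := q') (by omega)) (R.heavyAdj_pred_succ_right C)
    (by intro k; omega)).trans (C.down (i := s + 1) (j := q - 1) (by omega)) hc.symm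
    (by intro k; omega)).trans hp' he' (by intro k; omega)) (by intro k; omega)

theorem not_heavyAdj_mid_mid (R : G.Rung f m H a b q) (R' : G.Rung f m H b (s + m) q')
    (C : G.LongestCycle f m H) (hs : s ≤ a) : ¬ G.HeavyAdj (f q) (f q') := by
  intro hc
  have h1 := R.succ_lt_mid C
  have h2 := R.mid_lt
  have h1' := R'.succ_lt_mid C
  have h2' := R'.mid_lt
  obtain ⟨e, hp, he⟩ := R.exists_flip C
  obtain ⟨e', hp', he'⟩ := R'.exists_flip_reverse C
  exact R'.no_path_next C (((hp.trans (C.up (i := b + 1) (j := q') (by omega)) he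
    (by intro k; omega)).trans
    (C.down (i := s + 1) (j := q) (by omega)) hc.symm (by intro k; omega)).trans hp' he'
    (by intro k; omega)) (by intro k; omega)

/-- One of two consecutive rungs closes up to a triangle with the second vertex of its stretch. -/
theorem adj_two_mid_or (R : G.Rung f m H a b q) (R' : G.Rung f m H b (s + m) q')
    (C : G.LongestCycle f m H) (hs : s ≤ a) :
    G.Adj (f (a + 2)) (f q) ∨ G.Adj (f (b + 2)) (f q') := by
  have h1' := R'.succ_lt_mid C
  have h2' := R'.mid_lt
  have h1 := R.not_heavyAdj_two_two C (by omega)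
  have h2 := R.not_heavyAdj_mid_mid R' C hs
  rcases R.heavyAdj_two_mid C with h | h
  · exact Or.inl h
  rcases R'.heavyAdj_two_mid C with h' | h'
  · exact Or.inr h'
  -- Two nonadjacent heavy pairs would have total degree at least `2n`; regrouped as `(a + 2, b +
  -- 2)` and `(q, q')`, the same four degrees total less than `2n`.
  exfalso
  simp only [HeavyAdj, not_or, not_le] at h1 h2
  omega

/-- At one of two consecutive attached positions the last rung vertex and the successor are
adjacent. -/
theorem adj_mid_succ_or (R : G.Rung f m H a b q) (R' : G.Rung f m H b (s + m) q')
    (C : G.LongestCycle f m H) (hs : s ≤ a) :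
    G.Adj (f q) (f (b + 1)) ∨ G.Adj (f q') (f (s + m + 1)) := by
  have h1 := R'.not_heavyAdj_one_succ_right C
  have h2 := R.not_heavyAdj_mid_mid R' C hs
  rcases R.heavyAdj_mid_succ_right C with h | h
  · exact Or.inl h
  rcases R'.heavyAdj_mid_succ_right C with h' | h'
  · exact Or.inr h'
  -- The same regrouping of four degrees, now into `(q, q')` and `(b + 1, s + m + 1)`.
  exfalso
  simp only [HeavyAdj, not_or, not_le] at h1 h2
  omega

end TwoRungs
end Rung
end SimpleGraph

/-! ### Consequences of almost distance-heredity. -/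

namespace SimpleGraph

section
variable {V : Type*} {G : SimpleGraph V}

theorem reachable_induce_of_pathOn {S : Set V} {u v : V} {I : V → Prop} (hp : PathOn G.Adj u v I)
    (hI : ∀ w, I w → w ∈ S) (hu : u ∈ S) (hv : v ∈ S) :
    (G.induce S).Reachable ⟨u, hu⟩ ⟨v, hv⟩ := by
  obtain ⟨l, -, h2, h3, h4, h5⟩ := hp
  replace h5 : ∀ k ∈ l, k ∈ S := fun k hk => hI k ((h5 k).1 hk)
  induction l generalizing u with
  | nil => simp at h3
  | cons a l ih =>
    obtain rfl : a = u := by simpa using h3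
    cases l with
    | nil =>
      obtain rfl : a = v := by simpa using h4
      exact Reachable.refl _
    | cons b l =>
      have hb : b ∈ S := h5 b (by simp)
      have hab : (G.induce S).Adj ⟨a, hu⟩ ⟨b, hb⟩ := h2.rel
      exact hab.reachable.trans (ih hb h2.of_cons rfl (by simpa using h4)
        fun k hk => h5 k (by simp [hk]))

/-- A level function rising by at most one along each edge bounds distances from below. -/
theorem level_le_add_dist {S : Set V} (hS : (G.induce S).Connected) (φ : V → ℕ)
    (hφ : ∀ u ∈ S, ∀ v ∈ S, G.Adj u v → φ v ≤ φ u + 1) (x y : S) :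
    φ y ≤ φ x + (G.induce S).dist x y := by
  obtain ⟨p, hp⟩ := hS.exists_walk_length_eq_dist x y
  rw [← hp]
  clear hp
  induction p with
  | nil => simp
  | cons h p ih =>
    have := hφ _ (Subtype.prop _) _ (Subtype.prop _) h
    rw [Walk.length_cons]
    omega

/-- In an almost distance-hereditary graph there is no nearly induced path
`v₀ v₁ v₂ x v₃ v₄ v₅`, allowing only the chord `v₂v₃`, whose ends are at distance at most three. -/
theorem IsAlmostDistanceHereditary.no_long_path (hG : G.IsAlmostDistanceHereditary)
    {v₀ v₁ v₂ x v₃ v₄ v₅ w w' : V} (h01 : G.Adj v₀ v₁) (h12 : G.Adj v₁ v₂) (h2x : G.Adj v₂ x)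
    (hx3 : G.Adj x v₃) (h34 : G.Adj v₃ v₄) (h45 : G.Adj v₄ v₅)
    (n02 : ¬ G.Adj v₀ v₂) (n0x : ¬ G.Adj v₀ x) (n03 : ¬ G.Adj v₀ v₃) (n04 : ¬ G.Adj v₀ v₄)
    (n05 : ¬ G.Adj v₀ v₅) (n1x : ¬ G.Adj v₁ x) (n13 : ¬ G.Adj v₁ v₃) (n14 : ¬ G.Adj v₁ v₄)
    (n15 : ¬ G.Adj v₁ v₅) (n24 : ¬ G.Adj v₂ v₄) (n25 : ¬ G.Adj v₂ v₅) (nx4 : ¬ G.Adj x v₄)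
    (nx5 : ¬ G.Adj x v₅) (n35 : ¬ G.Adj v₃ v₅)
    (hw : G.Adj v₀ w) (hww' : G.Adj w w') (hw' : G.Adj w' v₅) : False := by
  classical
  let S : Set V := {v₀, v₁, v₂, x, v₃, v₄, v₅}
  have m0 : v₀ ∈ S := by simp [S]
  have m1 : v₁ ∈ S := by simp [S]
  have m2 : v₂ ∈ S := by simp [S]
  have mx : x ∈ S := by simp [S]
  have m3 : v₃ ∈ S := by simp [S]
  have m4 : v₄ ∈ S := by simp [S]
  have m5 : v₅ ∈ S := by simp [S]
  have r1 : (G.induce S).Reachable ⟨v₀, m0⟩ ⟨v₁, m1⟩ :=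
    Adj.reachable (show (G.induce S).Adj _ _ from h01)
  have r2 : (G.induce S).Reachable ⟨v₀, m0⟩ ⟨v₂, m2⟩ :=
    r1.trans (Adj.reachable (show (G.induce S).Adj _ _ from h12))
  have rx : (G.induce S).Reachable ⟨v₀, m0⟩ ⟨x, mx⟩ :=
    r2.trans (Adj.reachable (show (G.induce S).Adj _ _ from h2x))
  have r3 : (G.induce S).Reachable ⟨v₀, m0⟩ ⟨v₃, m3⟩ :=
    rx.trans (Adj.reachable (show (G.induce S).Adj _ _ from hx3))
  have r4 : (G.induce S).Reachable ⟨v₀, m0⟩ ⟨v₄, m4⟩ :=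
    r3.trans (Adj.reachable (show (G.induce S).Adj _ _ from h34))
  have r5 : (G.induce S).Reachable ⟨v₀, m0⟩ ⟨v₅, m5⟩ :=
    r4.trans (Adj.reachable (show (G.induce S).Adj _ _ from h45))
  have hS : (G.induce S).Connected := by
    rw [connected_iff_exists_forall_reachable]
    refine ⟨⟨v₀, m0⟩, ?_⟩
    rintro ⟨y, hy⟩
    have hy' := hy
    simp only [S, Set.mem_insert_iff, Set.mem_singleton_iff] at hy'
    rcases hy' with rfl | rfl | rfl | rfl | rfl | rfl | rfl
    exacts [Reachable.refl _, r1, r2, rx, r3, r4, r5]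
  -- Giving `v₂` and `x` the same level accommodates the possible chord `v₂v₃`; the ends still
  -- differ by 5.
  let φ : V → ℕ := fun v => if v = v₀ then 0 else if v = v₁ then 1 else
    if v = v₂ ∨ v = x then 2 else if v = v₃ then 3 else if v = v₄ then 4 else 5
  have e0 : φ v₀ = 0 := by simp [φ]
  have e1 : φ v₁ = 1 := by simp [φ, h01.ne']
  have d20 : v₂ ≠ v₀ := by rintro rfl; exact n0x h2x
  have dx0 : x ≠ v₀ := by rintro rfl; exact n03 hx3
  have dx1 : x ≠ v₁ := by rintro rfl; exact n13 hx3
  have d30 : v₃ ≠ v₀ := by rintro rfl; exact n04 h34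
  have d31 : v₃ ≠ v₁ := by rintro rfl; exact n14 h34
  have d32 : v₃ ≠ v₂ := by rintro rfl; exact n24 h34
  have d40 : v₄ ≠ v₀ := by rintro rfl; exact n05 h45
  have d41 : v₄ ≠ v₁ := by rintro rfl; exact n15 h45
  have d42 : v₄ ≠ v₂ := by rintro rfl; exact n25 h45
  have d4x : v₄ ≠ x := by rintro rfl; exact nx5 h45
  have d50 : v₅ ≠ v₀ := by rintro rfl; exact n04 h45.symm
  have d51 : v₅ ≠ v₁ := by rintro rfl; exact n05 h01
  have d52 : v₅ ≠ v₂ := by rintro rfl; exact n15 h12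
  have d5x : v₅ ≠ x := by rintro rfl; exact n25 h2x
  have d53 : v₅ ≠ v₃ := by rintro rfl; exact nx5 hx3
  have e2 : φ v₂ = 2 := by simp [φ, d20, h12.ne']
  have ex : φ x = 2 := by simp [φ, dx0, dx1]
  have e3 : φ v₃ = 3 := by simp [φ, d30, d31, d32, hx3.ne']
  have e4 : φ v₄ = 4 := by simp [φ, d40, d41, d42, d4x, h34.ne']
  have e5 : φ v₅ = 5 := by simp [φ, d50, d51, d52, d5x, d53, h45.ne']
  have hφ : ∀ u ∈ S, ∀ v ∈ S, G.Adj u v → φ v ≤ φ u + 1 := by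
    intro u hu v hv huv
    simp only [S, Set.mem_insert_iff, Set.mem_singleton_iff] at hu hv
    rcases hu with rfl | rfl | rfl | rfl | rfl | rfl | rfl <;>
      rcases hv with rfl | rfl | rfl | rfl | rfl | rfl | rfl <;>
      first
        | omega
        | contradiction
  have h1 := level_le_add_dist hS φ hφ ⟨v₀, m0⟩ ⟨v₅, m5⟩
  have h2 := hG S hS ⟨v₀, m0⟩ ⟨v₅, m5⟩
  have h3 : G.dist v₀ v₅ ≤ 3 := dist_le (.cons hw (.cons hww' (.cons hw' .nil)))
  simp only [e0, e5] at h1 h2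
  omega

end

variable {V : Type*} [Fintype V] {G : SimpleGraph V} [DecidableRel G.Adj] {f : ℕ → V} {m : ℕ}
  {H : Set V}

namespace LongestCycle

/-- Between consecutive attached positions of an almost distance-hereditary graph there is a rung,
and the neighbours in `H` are shared. -/
theorem exists_rung (C : G.LongestCycle f m H) (hG : G.IsAlmostDistanceHereditary) {a b : ℕ}
    (hb : G.Attached f H b) (hab : a < b) (hbm : b < a + m)
    (hbetween : ∀ k, a < k → k < b → ¬ G.Attached f H k) {x : V} (hx : x ∈ H)
    (hax : G.Adj (f a) x) : G.Adj (f b) x ∧ ∃ q, G.Rung f m H a b q := by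
  have ha : G.Attached f H a := ⟨x, hx, hax⟩
  have hne : a + 1 ≠ b := by rintro rfl; exact C.not_attached_succ ha hb
  have hnb : ¬ G.Adj (f (a + 1)) (f b) := fun h =>
    C.not_heavyAdj_attached_succ ha hb hab hbm h.symm.heavyAdj
  -- Leaving out `f a` forces every route from `x` to `f (a + 1)` through `f b`.
  let S : Set V := {v | v ∈ H ∨ v = f b ∨ ∃ k, a < k ∧ k < b ∧ v = f k}
  have mH : ∀ v, v ∈ H → v ∈ S := fun v hv => Or.inl hv
  have mb : f b ∈ S := Or.inr (Or.inl rfl)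
  have mI : ∀ k, a < k → k < b → f k ∈ S := fun k h1 h2 => Or.inr (Or.inr ⟨k, h1, h2, rfl⟩)
  have hS : (G.induce S).Connected := by
    rw [connected_iff_exists_forall_reachable]
    refine ⟨⟨f b, mb⟩, ?_⟩
    rintro ⟨v, hv | rfl | ⟨k, hk1, hk2, rfl⟩⟩
    · obtain ⟨u, hu, hbu⟩ := hb
      have h1 : (G.induce S).Adj ⟨f b, mb⟩ ⟨u, mH u hu⟩ := hbu
      obtain ⟨I, hp, hI⟩ := C.path u hu v hv
      exact h1.reachable.trans (reachable_induce_of_pathOn hp (fun w hw => mH w (hI w hw)) _ _)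
    · exact Reachable.refl _
    · have : ∀ n, ∀ k (h1 : a < k) (h2 : k < b), b = k + n →
          (G.induce S).Reachable ⟨f b, mb⟩ ⟨f k, mI k h1 h2⟩ := by
        intro n
        induction n with
        | zero => intro k h1 h2 h3; omega
        | succ n ih =>
          intro k h1 h2 h3
          by_cases hk : k + 1 < b
          · have h4 : (G.induce S).Adj ⟨f (k + 1), mI (k + 1) (by omega) hk⟩ ⟨f k, mI k h1 h2⟩ :=
              (C.adj k).symm
            exact (ih (k + 1) (by omega) hk (by omega)).trans h4.reachable
          · obtain rfl : b = k + 1 := by omega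
            have h4 : (G.induce S).Adj ⟨f (k + 1), mb⟩ ⟨f k, mI k h1 h2⟩ := (C.adj k).symm
            exact h4.reachable
      exact this (b - k) k hk1 hk2 (by omega)
  have hdist : (G.induce S).dist ⟨x, mH x hx⟩ ⟨f (a + 1), mI (a + 1) (by omega) (by omega)⟩ ≤ 3 := by
    refine (hG S hS _ _).trans ?_
    have : G.dist x (f (a + 1)) ≤ 2 := dist_le (.cons hax.symm (.cons (C.adj a) .nil))
    exact Nat.add_le_add_right this 1
  have hHI : ∀ h ∈ H, ∀ k, a < k → k < b → ¬ G.Adj h (f k) := fun h hh k h1 h2 h3 =>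
    hbetween k h1 h2 ⟨h, hh, h3.symm⟩
  obtain ⟨p, hp⟩ := hS.exists_walk_length_eq_dist ⟨x, mH x hx⟩
    ⟨f (a + 1), mI (a + 1) (by omega) (by omega)⟩
  rw [← hp] at hdist
  have key : ∀ y ∈ S, G.Adj x y → y ∈ H ∨ y = f b := by
    rintro y (hy | hy | ⟨k, h1, h2, rfl⟩) hxy
    · exact Or.inl hy
    · exact Or.inr hy
    · exact absurd hxy (hHI x hx k h1 h2)
  have key' : ∀ z ∈ S, G.Adj z (f (a + 1)) → ∃ k, a < k ∧ k < b ∧ z = f k := by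
    rintro z (hz | rfl | hz) hza
    · exact absurd hza (hHI z hz (a + 1) (by omega) (by omega))
    · exact absurd hza.symm hnb
    · exact hz
  -- A walk of length at most 3 can only be `x`, `f b`, `f q`, `f (a + 1)`.
  rcases p with _ | ⟨h1, p⟩
  · exact absurd hx (C.notMem (a + 1))
  rename_i y
  obtain ⟨y, hy⟩ := y
  change G.Adj x y at h1
  rcases p with _ | ⟨h2, p⟩
  · exact absurd h1 (hHI x hx (a + 1) (by omega) (by omega))
  rename_i z
  obtain ⟨z, hz⟩ := z
  change G.Adj y z at h2
  rcases p with _ | ⟨h3, p⟩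
  · obtain ⟨k, hk1, hk2, rfl⟩ := key' y hy h2
    exact absurd h1 (hHI x hx k hk1 hk2)
  rename_i t
  obtain ⟨t, ht⟩ := t
  change G.Adj z t at h3
  rcases p with _ | ⟨h4, p⟩
  · obtain ⟨k, hk1, hk2, rfl⟩ := key' z hz h3
    rcases key y hy h1 with h | rfl
    · exact absurd h2 (hHI y h k hk1 hk2)
    · refine ⟨h1.symm, k, ha, hb, hbm, hbetween, ?_, hk2, h3.symm, h2.symm⟩
      have : k ≠ a + 1 := by rintro rfl; exact G.irrefl h3
      omega
  · change p.length + 1 + 1 + 1 + 1 ≤ 3 at hdist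
    omega

end LongestCycle

/-- Two consecutive rungs that are linked at their common attached position contradict almost
distance-heredity. -/
theorem Rung.false_of_adj {a b q s q' : ℕ} (R : G.Rung f m H a b q)
    (R' : G.Rung f m H b (s + m) q') (C : G.LongestCycle f m H)
    (hG : G.IsAlmostDistanceHereditary) (hs : s ≤ a) {x : V} (hx : x ∈ H) (hax : G.Adj (f a) x)
    (hbx : G.Adj (f b) x) (hdx : G.Adj (f (s + m)) x) (hq : G.Adj (f q) (f (b + 1))) : False := by
  have h1 := R.succ_lt_mid C
  have h2 := R.mid_lt
  have h1' := R'.succ_lt_mid C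
  have h2' := R'.mid_lt
  have hqq := R.not_heavyAdj_mid_mid R' C hs
  have hpq := R.not_heavyAdj_pred_mid_mid R' C hs
  have nx : ∀ k, ¬ G.Attached f H k → ¬ G.Adj (f k) x := fun k hk h => hk ⟨x, hx, h⟩
  have hq1 : G.Adj (f (q - 1)) (f q) := by
    have := C.adj (q - 1)
    rwa [Nat.sub_add_cancel (by omega)] at this
  have hbtw := R.between
  have hbtw' := R'.between
  rcases R.adj_two_mid_or R' C hs with h | h
  -- The path `a + 2, a + 1, a, x, b, b + 1, b + 2` has the shortcut `a + 2, q, b + 1, b + 2`.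
  · refine hG.no_long_path (C.adj (a + 1)).symm (C.adj a).symm hax hbx.symm (C.adj b)
      (C.adj (b + 1)) ?_ ?_ ?_ ?_ ?_ ?_ ?_ ?_ ?_ ?_ ?_ ?_ ?_ ?_ h hq (C.adj (b + 1))
    · exact fun h => R.not_heavyAdj_left_two C h.symm.heavyAdj
    · exact nx _ (hbtw _ (by omega) (by omega))
    · exact fun h => R.not_heavyAdj_two_right C h.heavyAdj
    · exact fun h => R.not_heavyAdj_two_succ_right C h.heavyAdj
    · exact fun h => R.not_heavyAdj_two_two C (by omega) h.heavyAdj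
    · exact nx _ (hbtw _ (by omega) (by omega))
    · exact fun h => R.not_heavyAdj_one_right C h.heavyAdj
    · exact fun h => R.not_heavyAdj_one_succ_right C h.heavyAdj
    · exact fun h => R.not_heavyAdj_one_two C (by omega) h.heavyAdj
    · exact fun h => R.not_heavyAdj_left_succ_right C h.heavyAdj
    · exact fun h => R.not_heavyAdj_one_two C (by omega) (C.heavyAdj_of_common R.left
        (hbtw _ (by omega) (by omega)) (hbtw' _ (by omega) (by omega)) (C.adj a) h
        (C.ne_of_lt (by omega) (by omega)))
    · exact fun h => nx _ (hbtw' _ (by omega) (by omega)) h.symm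
    · exact fun h => nx _ (hbtw' _ (by omega) (by omega)) h.symm
    · exact fun h => R'.not_heavyAdj_left_two C h.heavyAdj
  -- The path `q - 1, q, b, x, s + m, q', b + 2` has the shortcut `q - 1, q, b + 1, b + 2`.
  · refine hG.no_long_path hq1 R.adj_right hbx hdx.symm R'.adj_right.symm h.symm
      ?_ ?_ ?_ ?_ ?_ ?_ ?_ ?_ ?_ ?_ ?_ ?_ ?_ ?_ hq1 hq (C.adj (b + 1))
    · exact fun h => R.not_heavyAdj_pred_mid_right C h.heavyAdj
    · exact nx _ (hbtw _ (by omega) (by omega))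
    · exact fun h => hpq (C.heavyAdj_of_common R'.right (hbtw _ (by omega) (by omega))
        R'.not_attached_mid h.symm R'.adj_right.symm (C.ne_of_lt (by omega) (by omega)))
    · exact fun h => hpq h.heavyAdj
    · exact fun h => R.not_heavyAdj_pred_mid_two C (by omega) h.heavyAdj
    · exact nx _ R.not_attached_mid
    · exact fun h => hqq (C.heavyAdj_of_common R'.right R.not_attached_mid
        R'.not_attached_mid h.symm R'.adj_right.symm (C.ne_of_lt (by omega) (by omega)))
    · exact fun h => hqq h.heavyAdj
    · exact fun h => R.not_heavyAdj_mid_two_next R' C hs h.heavyAdj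
    · exact fun h => R'.not_heavyAdj_left_mid C h.heavyAdj
    · exact fun h => R'.not_heavyAdj_left_two C h.heavyAdj
    · exact fun h => nx _ R'.not_attached_mid h.symm
    · exact fun h => nx _ (hbtw' _ (by omega) (by omega)) h.symm
    · exact fun h => R'.not_heavyAdj_two_right C h.symm.heavyAdj

end SimpleGraph

/-! ### Existence of the configuration, and the conclusion. -/

namespace SimpleGraph

variable {V : Type*} [Fintype V]

theorem exists_next_attached {V : Type*} {G : SimpleGraph V} {f : ℕ → V} {m : ℕ} {H : Set V}
    (h2 : ∀ a, G.Attached f H a → ∃ k, a < k ∧ k < a + m ∧ G.Attached f H k) {a : ℕ}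
    (ha : G.Attached f H a) : ∃ b, a < b ∧ b < a + m ∧ G.Attached f H b ∧
      ∀ k, a < k → k < b → ¬ G.Attached f H k := by
  classical
  have hex := h2 a ha
  obtain ⟨h3, h4, h5⟩ := Nat.find_spec hex
  refine ⟨Nat.find hex, h3, h4, h5, fun k hk1 hk2 hk3 => Nat.find_min hex hk2 ⟨hk1, by omega, hk3⟩⟩

namespace LongestCycle

variable {G : SimpleGraph V} [DecidableRel G.Adj] {f : ℕ → V} {m : ℕ} {H : Set V}

theorem false_of_attached (C : G.LongestCycle f m H) (hG : G.IsAlmostDistanceHereditary)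
    (h2 : ∀ a, G.Attached f H a → ∃ k, a < k ∧ k < a + m ∧ G.Attached f H k) {a : ℕ}
    (ha : G.Attached f H a) : False := by
  -- This keeps `d - m` and `e - m` below from truncating.
  wlog ham : m ≤ a generalizing a
  · exact this ((C.attached_add a).2 ha) (by omega)
  obtain ⟨b, hab, hbm, hb, hab'⟩ := exists_next_attached h2 ha
  obtain ⟨d, hbd, hdm, hd, hbd'⟩ := exists_next_attached h2 hb
  -- A third rung is needed because the edge from `adj_mid_succ_or` may sit at `d`, where the second
  -- and third rungs meet.
  obtain ⟨e, hde, hem, he, hde'⟩ := exists_next_attached h2 hd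
  have hda : d ≤ a + m := by
    by_contra h
    exact hbd' (a + m) (by omega) (by omega) ((C.attached_add a).2 ha)
  have heb : e ≤ b + m := by
    by_contra h
    exact hde' (b + m) (by omega) (by omega) ((C.attached_add b).2 hb)
  have ha' := ha
  obtain ⟨x, hx, hax⟩ := ha'
  obtain ⟨hbx, q₁, R₁⟩ := C.exists_rung hG hb hab hbm hab' hx hax
  obtain ⟨hdx, q₂, R₂⟩ := C.exists_rung hG hd hbd hdm hbd' hx hbx
  obtain ⟨hex, q₃, R₃⟩ := C.exists_rung hG he hde hem hde' hx hdx
  obtain ⟨s, rfl⟩ : ∃ s, d = s + m := ⟨d - m, by omega⟩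
  obtain ⟨t, rfl⟩ : ∃ t, e = t + m := ⟨e - m, by omega⟩
  rcases R₁.adj_mid_succ_or R₂ C (by omega) with h | h
  · exact R₁.false_of_adj R₂ C hG (by omega) hx hax hbx hdx h
  · exact R₂.false_of_adj R₃ C hG (by omega) hx hbx hdx hex h

theorem exists_eq_in_window (C : G.LongestCycle f m H) (i s : ℕ) :
    ∃ k, s < k ∧ k ≤ s + m ∧ f k = f i := by
  have hm := C.three_le
  have hp : Function.Periodic f m := C.periodic
  -- Adding `(s + 1) * m` keeps the subtraction from truncating.
  refine ⟨s + 1 + (i + (s + 1) * m - (s + 1)) % m, by omega, ?_, ?_⟩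
  · have := Nat.mod_lt (i + (s + 1) * m - (s + 1)) (by omega : 0 < m)
    omega
  · have h1 : s + 1 ≤ (s + 1) * m := Nat.le_mul_of_pos_right _ (by omega)
    rw [← hp.map_mod_nat, Nat.add_mod_mod, hp.map_mod_nat,
      show s + 1 + (i + (s + 1) * m - (s + 1)) = i + (s + 1) * m by omega]
    exact hp.nat_mul (s + 1) i

end LongestCycle

theorem exists_adj_of_connected_induce {V : Type*} {G : SimpleGraph V} {T : Set V}
    (hT : (G.induce T).Connected) (X : Set V) {u w : V} (hu : u ∈ T) (hw : w ∈ T) (huX : u ∈ X)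
    (hwX : w ∉ X) : ∃ y ∈ X, ∃ z, z ∉ X ∧ y ∈ T ∧ z ∈ T ∧ G.Adj y z := by
  obtain ⟨p⟩ := hT.preconnected ⟨u, hu⟩ ⟨w, hw⟩
  obtain ⟨d, -, h1, h2⟩ := p.exists_boundary_dart {v | (v : V) ∈ X} huX hwX
  exact ⟨_, h1, _, h2, Subtype.prop _, Subtype.prop _, d.adj⟩

theorem exists_pathOn_of_reachable {V : Type*} {G : SimpleGraph V} {T : Set V} {u v : T}
    (h : (G.induce T).Reachable u v) : ∃ I, PathOn G.Adj (u : V) v I ∧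
      ∀ w, I w → ∃ hw : w ∈ T, (G.induce T).Reachable u ⟨w, hw⟩ := by
  classical
  obtain ⟨p, hp⟩ := h.exists_isPath
  refine ⟨fun w => w ∈ p.support.map Subtype.val, ⟨p.support.map Subtype.val, ?_, ?_, ?_, ?_,
    fun k => Iff.rfl⟩, ?_⟩
  · exact hp.support_nodup.map Subtype.val_injective
  · rw [List.isChain_map]
    exact p.isChain_adj_support
  · rw [List.head?_map, List.head?_eq_some_head p.support_ne_nil]
    simp
  · rw [List.getLast?_map, List.getLast?_eq_some_getLast p.support_ne_nil]
    simp
  · intro w hw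
    obtain ⟨y, hy, rfl⟩ := List.mem_map.1 hw
    exact ⟨y.2, ⟨p.takeUntil y hy⟩⟩

theorem IsVertexConnected.connected_compl_singleton [DecidableEq V] {G : SimpleGraph V}
    (h2 : G.IsVertexConnected 2) (u : V) : (G.induce {v : V | v ≠ u}).Connected := by
  have h := h2.2 {u} (by simp)
  have e : {v : V | v ∉ ({u} : Finset V)} = {v : V | v ≠ u} := by ext; simp
  rwa [e] at h

theorem IsVertexConnected.connected_univ [DecidableEq V] {G : SimpleGraph V}
    (h2 : G.IsVertexConnected 2) : (G.induce {_v : V | True}).Connected := by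
  have h := h2.2 ∅ (by simp)
  have e : {v : V | v ∉ (∅ : Finset V)} = {_v : V | True} := by ext; simp
  rwa [e] at h

/-- For an edge `uv`, the vertex `u` has a second neighbour `t`, as deleting `v` does not isolate
it. A path from `t` to `v` avoiding `u` closes up at `u`. -/
theorem IsVertexConnected.exists_cycleList [DecidableEq V] {G : SimpleGraph V}
    (h2 : G.IsVertexConnected 2) : ∃ l, IsCycleList G.Adj l := by
  obtain ⟨u, u', huu'⟩ := Fintype.exists_pair_of_one_lt_card
    (by have := h2.1; omega : 1 < Fintype.card V)
  obtain ⟨y, hy, v, hv, -, -, huv⟩ := exists_adj_of_connected_induce h2.connected_univ {u}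
    (u := u) (w := u') trivial trivial rfl (Ne.symm huu')
  rw [Set.mem_singleton_iff.1 hy] at huv
  obtain ⟨w, hw⟩ : ∃ w, w ∉ ({u, v} : Finset V) := by
    by_contra! h
    have h3 := Finset.card_le_card (fun z _ => h z : Finset.univ ⊆ {u, v})
    have h4 := Finset.card_le_two (a := u) (b := v)
    have := h2.1
    rw [Finset.card_univ] at h3
    omega
  simp only [Finset.mem_insert, Finset.mem_singleton, not_or] at hw
  obtain ⟨z, hz, t, ht, -, htv, hut⟩ := exists_adj_of_connected_induce
    (h2.connected_compl_singleton v) {u} (u := u) (w := w) huv.ne hw.2 rfl hw.1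
  rw [Set.mem_singleton_iff.1 hz] at hut
  have htv : t ≠ v := htv
  obtain ⟨I, ⟨l, h3, h4, h5, h6, h7⟩, hI⟩ := exists_pathOn_of_reachable
    ((h2.connected_compl_singleton u).preconnected ⟨t, hut.ne'⟩ ⟨v, huv.ne'⟩)
  refine ⟨u :: l, ?_, ?_, ?_, ?_⟩
  · rcases l with _ | ⟨a, _ | ⟨b, l⟩⟩
    · simp at h5
    · simp only [List.head?_cons, Option.some.injEq] at h5
      simp only [List.getLast?_singleton, Option.some.injEq] at h6
      exact absurd (h5.symm.trans h6) htv
    · simp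
  · rw [List.nodup_cons]
    refine ⟨fun hu => ?_, h3⟩
    obtain ⟨h8, -⟩ := hI u ((h7 u).1 hu)
    exact h8 rfl
  · refine List.IsChain.cons h4 ?_
    rw [h5]
    simpa using hut
  · have : (u :: l).getLast? = some v := by
      rw [List.getLast?_cons, h6]; rfl
    rw [this]
    simpa using huv.symm

theorem exists_longest_cycleList {G : SimpleGraph V} (h : ∃ l, IsCycleList G.Adj l) :
    ∃ l, IsCycleList G.Adj l ∧ ∀ l', IsCycleList G.Adj l' → l'.length ≤ l.length := by
  classical
  let P : ℕ → Prop := fun n => ∃ l, IsCycleList G.Adj l ∧ l.length = n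
  have hb : ∀ l, IsCycleList G.Adj l → l.length ≤ Fintype.card V := fun l hl =>
    hl.nodup.length_le_card
  obtain ⟨l₀, h₀⟩ := h
  obtain ⟨l, h1, h2⟩ := Nat.findGreatest_spec (P := P) (hb l₀ h₀) ⟨l₀, h₀, rfl⟩
  exact ⟨l, h1, fun l' h' => h2 ▸ Nat.le_findGreatest (hb l' h') ⟨l', h', rfl⟩⟩

theorem exists_longestCycle {G : SimpleGraph V} [DecidableRel G.Adj] (hG : G.IsClawHeavy)
    {l : List V} (hl : IsCycleList G.Adj l)
    (hmax : ∀ l', IsCycleList G.Adj l' → l'.length ≤ l.length) {h₀ : V} (h : h₀ ∉ l) :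
    ∃ f H, G.LongestCycle f l.length H ∧ (∀ v, v ∈ l ↔ ∃ i, f i = v) ∧ h₀ ∈ H := by
  have hlen := hl.three_le
  have hpos : 0 < l.length := by omega
  let f : ℕ → V := fun i => l[i % l.length]'(Nat.mod_lt _ hpos)
  have hf : ∀ i, f i = l[i % l.length]'(Nat.mod_lt _ hpos) := fun _ => rfl
  have hmem : ∀ v, v ∈ l ↔ ∃ i, f i = v := by
    intro v
    constructor
    · intro hv
      obtain ⟨i, hi, rfl⟩ := List.getElem_of_mem hv
      exact ⟨i, by simp only [hf, Nat.mod_eq_of_lt hi]⟩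
    · rintro ⟨i, rfl⟩
      exact List.getElem_mem _
  let T : Set V := {v | v ∉ l}
  let H : Set V := {v | ∃ hv : v ∈ T, (G.induce T).Reachable ⟨h₀, h⟩ ⟨v, hv⟩}
  refine ⟨f, H, ⟨hG, hlen, ?_, ?_, ?_, hmax, ?_, ?_, ?_⟩, hmem, ⟨h, Reachable.refl _⟩⟩
  · intro i
    simp only [hf, Nat.add_mod_right]
  · intro i
    have hi := Nat.mod_lt i hpos
    by_cases hc : i % l.length + 1 < l.length
    · have e : (i + 1) % l.length = i % l.length + 1 := by
        rw [Nat.add_mod, Nat.mod_eq_of_lt (by omega : 1 < l.length), Nat.mod_eq_of_lt hc]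
      simp only [hf, e]
      exact hl.isChain.getElem _ hc
    · have e1 : i % l.length = l.length - 1 := by omega
      have e : (i + 1) % l.length = 0 := by
        rw [Nat.add_mod, Nat.mod_eq_of_lt (by omega : 1 < l.length), e1,
          Nat.sub_add_cancel (by omega), Nat.mod_self]
      simp only [hf, e, e1]
      refine hl.closing _ ?_ _ ?_
      · rw [List.getLast?_eq_getElem?]; simp
      · rw [List.head?_eq_getElem?]; simp
  · intro i j hij
    simp only [hf] at hij
    exact (hl.nodup.getElem_inj_iff).1 hij
  · rintro i ⟨hi, -⟩
    exact hi ((hmem _).2 ⟨i, rfl⟩)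
  · rintro u ⟨hu, hru⟩ v huv
    by_cases hv : v ∈ l
    · exact Or.inr ((hmem v).1 hv)
    · refine Or.inl ⟨hv, hru.trans ?_⟩
      exact Adj.reachable (show (G.induce T).Adj ⟨u, hu⟩ ⟨v, hv⟩ from huv)
  · rintro u ⟨hu, hru⟩ v ⟨hv, hrv⟩
    obtain ⟨I, hp, hI⟩ := exists_pathOn_of_reachable (hru.symm.trans hrv)
    refine ⟨I, hp, fun w hw => ?_⟩
    obtain ⟨hwT, hrw⟩ := hI w hw
    exact ⟨hwT, hru.trans hrw⟩

end SimpleGraph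

theorem theorem3 {V : Type*} [Fintype V] [DecidableEq V] (G : SimpleGraph V)
    [DecidableRel G.Adj] (h2 : G.IsVertexConnected 2) (hheavy : G.IsClawHeavy)
    (hadh : G.IsAlmostDistanceHereditary) : G.IsHamiltonian := by
  obtain ⟨l, hl, hmax⟩ := SimpleGraph.exists_longest_cycleList h2.exists_cycleList
  by_cases hall : ∀ v, v ∈ l
  · exact G.isHamiltonian_of_cycleList hl hall
  push Not at hall
  obtain ⟨h₀, hh₀⟩ := hall
  obtain ⟨f, H, C, hmem, h0H⟩ := SimpleGraph.exists_longestCycle hheavy hl hmax hh₀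
  have hm := C.three_le
  -- With `T` everything this gives one attached vertex `f a`; with `f a` deleted, another.
  have hcross : ∀ (T : Set V), (G.induce T).Connected → h₀ ∈ T → ∀ i, f i ∈ T →
      ∃ k, f k ∈ T ∧ G.Attached f H k := by
    intro T hT h0T i hi
    obtain ⟨y, hy, z, hz, -, hzT, hyz⟩ :=
      SimpleGraph.exists_adj_of_connected_induce hT H h0T hi h0H (C.notMem i)
    rcases C.closed y hy z hyz with h | ⟨k, rfl⟩
    · exact absurd h hz
    · exact ⟨k, hzT, y, hy, hyz.symm⟩
  obtain ⟨a, -, ha⟩ := hcross _ h2.connected_univ trivial 0 trivial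
  refine (C.false_of_attached hadh ?_ ha).elim
  intro a ha
  obtain ⟨k, hk, hka⟩ := hcross _ (h2.connected_compl_singleton (f a))
    (fun e => C.notMem a (e ▸ h0H)) (a + 1) (C.ne_of_lt (by omega) (by omega)).symm
  obtain ⟨k', h3, h4, h5⟩ := C.exists_eq_in_window k a
  refine ⟨k', h3, ?_, ?_⟩
  · rcases h4.lt_or_eq with h | rfl
    · exact h
    · rw [C.periodic] at h5
      exact absurd h5.symm hk
  · rwa [SimpleGraph.Attached, h5]
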